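/- Let $D$ be a division ring. Call a division ring $E$ right algebraically closed if for every nonconstant polynomial $\sum_k a_k x^k\in E[x]$ (with $x$ a central indeterminate) there is $b\in E$ with $\sum_k a_k b^k=0$. Call $D$ centrally algebraically closed if for every $m$ and all pairwise commuting $a_1,\dots,a_m\in D$ the centralizer of $\{a_1,\dots,a_m\}$ in $D$ is right algebraically closed. Let $D[x_1,\dots,x_n]$ be the ring of polynomials in $n$ central, mutually commuting indeterminates over $D$. For a point $c=(c_1,\dots,c_n)\in D^n$ with pairwise commuting coordinates and $f=\sum_m d_m x_1^{m_1}\cdots x_n^{m_n}$, put $f(c)=\sum_m d_m c_1^{m_1}\cdots c_n^{m_n}$. The c-zero locus of a set $S\subseteq D[x_1,\dots,x_n]$ is the set of all points $c\in D^n$ with pairwise commuting coordinates such that $f(c)=0$ for all $f\in S$. Theorem (Hilbert's Nullstellensatz). Let $D$ be a centrally algebraically closed division ring, let $I$ be a left ideal of $D[x_1,\dots,x_n]$, and let $p\in D[x_1,\dots,x_n]$. Then $p$ vanishes at every point of the c-zero locus of $I$ if and only if for every $a\in D$ there exists a natural number $N\ge 1$ such that \[(ap)^N\in I+I(ap)+I(ap)^2+\cdots+I(ap)^N,\]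 where $I(ap)^k=\{h\,(ap)^k : h\in I\}$. -/

import Mathlib

/-- `D[x₁,…,xₙ]`: polynomials in `n` central (mutually commuting) indeterminates over a possibly
noncommutative ring `D`, that is, the algebra of the additive monoid `ℕⁿ` of exponents. -/
abbrev CentralMvPoly (n : ℕ) (D : Type*) [Ring D] : Type _ :=
  AddMonoidAlgebra D (Fin n →₀ ℕ)

namespace CentralMvPoly

variable {n : ℕ} {D : Type*} [Ring D]

/-- The constant polynomial `a`. -/
noncomputable def C (a : D) : CentralMvPoly n D :=
  AddMonoidAlgebra.single 0 a

/-- The set `Dⁿ_c` of points of `Dⁿ` with pairwise commuting coordinates. -/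
def commutingPoints (n : ℕ) (D : Type*) [Ring D] : Set (Fin n → D) :=
  {c | ∀ i j, c i * c j = c j * c i}

/-- Evaluation of `f = ∑ d_m x₁^{m₁} ⋯ xₙ^{mₙ}` as a left polynomial, that is, with coefficients on
the left: `f(c) = ∑ d_m c₁^{m₁} ⋯ cₙ^{mₙ}`. It is only used at points of `Dⁿ_c`, where the order
of the factors `cᵢ^{mᵢ}` does not matter. -/
noncomputable def eval (c : Fin n → D) (f : CentralMvPoly n D) : D :=
  f.coeff.sum fun m d => d * (List.ofFn fun i => c i ^ m i).prod

/-- The c-zero locus of a set of polynomials. -/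
def cZeroLocus (S : Set (CentralMvPoly n D)) : Set (Fin n → D) :=
  {c | c ∈ commutingPoints n D ∧ ∀ f ∈ S, eval c f = 0}

/-- The set `I + I q + I q² + ⋯ + I q^N` for a left ideal `I` and a polynomial `q`.
(`Ideal` means left ideal.) -/
def leftPowerSum (I : Ideal (CentralMvPoly n D)) (q : CentralMvPoly n D) (N : ℕ) :
    Set (CentralMvPoly n D) :=
  {f | ∃ h : ℕ → CentralMvPoly n D, (∀ k, h k ∈ I) ∧
    f = ∑ k ∈ Finset.range (N + 1), h k * q ^ k}

end CentralMvPoly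

/-- Every nonconstant polynomial `∑ aₖ xᵏ` in one central indeterminate over `D` has a right root,
that is, some `b` in `D` with `∑ aₖ bᵏ = 0`. (`Polynomial.eval` has the coefficients on the left.)
It is applied to division rings only. -/
def IsRightAlgClosed (D : Type*) [Ring D] : Prop :=
  ∀ f : Polynomial D, 0 < f.natDegree → ∃ b : D, f.eval b = 0

/-- Centrally algebraically closed: the centralizer of any finite tuple of pairwise commuting
elements is right algebraically closed. -/
def IsCentrallyAlgClosed (D : Type*) [DivisionRing D] : Prop :=
  ∀ (m : ℕ) (a : Fin m → D), a ∈ CentralMvPoly.commutingPoints m D →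
    IsRightAlgClosed (Subring.centralizer (Set.range a))

/-! ### Noncommutative Hilbert basis theorem. -/

section Noetherian

open Polynomial

/-! Evaluation at `c` is not multiplicative, but `(fg)(c)` depends on `g` only through `g(c)`
(`eval_mul`). If `p(c) ≠ 0` at a point of the locus, take `a = p(c)⁻¹`: then every power of `ap` has
value 1 at `c`, while every `h(ap)^k` with `h ∈ I` has value 0.

The converse is Rabinowitsch's trick with `q = ap`. In `R = D[x₁,…,xₙ][X]` consider the left ideal
generated by `I` and `1 - qX`. If it is all of `R`, comparing coefficients of powers of `X` gives
the required `N`. Otherwise the weak Nullstellensatz `exists_le_forall_sub_mem` puts it in a proper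
left ideal `M` containing all `xᵢ - cᵢ`; then `c` lies in the locus of `I`, so `q ∈ M`, hence `1 ∈
M`.

The weak Nullstellensatz has two inputs. A simple `R`-module is finite-dimensional over `D`
(`finite_of_smulSpan_eq_top`, a Zariski lemma proved by Nagata's substitution and a Noetherian
argument). On a finite-dimensional module the indeterminates have a common eigenvector with
commuting eigenvalues (`exists_common_eigenvector`), and this is where central algebraic closedness
enters. -/

theorem Ideal.mem_leadingCoeffNth_iff {R : Type*} [Ring R] {I : Ideal R[X]} {d : ℕ} {a : R} :
    a ∈ I.leadingCoeffNth d ↔ ∃ f ∈ I, f.degree ≤ d ∧ f.coeff d = a := by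
  simp only [Ideal.leadingCoeffNth, Ideal.degreeLE, Submodule.mem_map, Submodule.mem_inf,
    Polynomial.mem_degreeLE, Ideal.mem_ofPolynomial, lcoeff_apply]
  exact ⟨fun ⟨f, ⟨h1, h2⟩, h3⟩ => ⟨f, h2, h1, h3⟩, fun ⟨f, h2, h1, h3⟩ => ⟨f, ⟨h1, h2⟩, h3⟩⟩

theorem Ideal.leadingCoeffNth_le_succ {R : Type*} [Ring R] (I : Ideal R[X]) (d : ℕ) :
    I.leadingCoeffNth d ≤ I.leadingCoeffNth (d + 1) := by
  intro a ha
  obtain ⟨f, hf, hd, rfl⟩ := Ideal.mem_leadingCoeffNth_iff.1 ha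
  refine Ideal.mem_leadingCoeffNth_iff.2 ⟨X * f, I.mul_mem_left _ hf, ?_, coeff_X_mul _ _⟩
  rw [degree_le_iff_coeff_zero]
  intro m hm
  obtain _ | m := m
  · simp
  · rw [coeff_X_mul]
    refine coeff_eq_zero_of_degree_lt (hd.trans_lt ?_)
    have : d + 1 < m + 1 := by exact_mod_cast hm
    exact_mod_cast (by omega : d < m)

theorem Ideal.leadingCoeffNth_le_of_le {R : Type*} [Ring R] {I J : Ideal R[X]} (h : I ≤ J)
    (d : ℕ) : I.leadingCoeffNth d ≤ J.leadingCoeffNth d := by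
  intro a ha
  obtain ⟨f, hf, hd, rfl⟩ := Ideal.mem_leadingCoeffNth_iff.1 ha
  exact Ideal.mem_leadingCoeffNth_iff.2 ⟨f, h hf, hd, rfl⟩

/-- Subtracting an element of `I` with the same top coefficient lowers the degree, so induction on a
degree bound applies. -/
theorem Ideal.le_of_leadingCoeffNth_le {R : Type*} [Ring R] {I J : Ideal R[X]} (hIJ : I ≤ J)
    (h : ∀ d, J.leadingCoeffNth d ≤ I.leadingCoeffNth d) : J ≤ I := by
  suffices H : ∀ d : ℕ, ∀ f ∈ J, f.degree < d → f ∈ I from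
    fun f hf => H (f.natDegree + 1) f hf
      (degree_le_natDegree.trans_lt (by exact_mod_cast Nat.lt_succ_self _))
  intro d
  induction d with
  | zero =>
    intro f _ hd
    have : f = 0 := by
      ext m
      exact coeff_eq_zero_of_degree_lt (hd.trans_le (by exact_mod_cast Nat.zero_le m))
    simp [this]
  | succ d ih =>
    intro f hf hd
    have hd' : f.degree ≤ d := by
      rw [degree_le_iff_coeff_zero]
      intro m hm
      refine coeff_eq_zero_of_degree_lt (hd.trans_le ?_)
      have : d < m := by exact_mod_cast hm
      exact_mod_cast this
    obtain ⟨g, hg, hgd, hgf⟩ := Ideal.mem_leadingCoeffNth_iff.1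
      (h d (Ideal.mem_leadingCoeffNth_iff.2 ⟨f, hf, hd', rfl⟩))
    have hfg : f - g ∈ I := by
      refine ih _ (J.sub_mem hf (hIJ hg)) ?_
      rw [degree_lt_iff_coeff_zero]
      intro m hm
      rcases hm.eq_or_lt with rfl | hm
      · simp [hgf]
      · rw [coeff_sub, coeff_eq_zero_of_degree_lt (hd'.trans_lt (by exact_mod_cast hm)),
          coeff_eq_zero_of_degree_lt (hgd.trans_lt (by exact_mod_cast hm)), sub_zero]
    simpa using I.add_mem hfg hg

/-- Hilbert's basis theorem for left ideals over a possibly noncommutative ring. -/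
theorem Polynomial.isNoetherianRing_of_ring (R : Type*) [Ring R] [IsNoetherianRing R] :
    IsNoetherianRing R[X] := by
  rw [isNoetherianRing_iff, ← monotone_stabilizes_iff_noetherian]
  intro I
  have hmono : ∀ k l d e, k ≤ l → d ≤ e → Ideal.leadingCoeffNth (I k) d ≤ Ideal.leadingCoeffNth (I l) e :=
    fun k l d e hkl hde => (Ideal.leadingCoeffNth_le_of_le (I.monotone hkl) d).trans
      (monotone_nat_of_le_succ (Ideal.leadingCoeffNth_le_succ (I l)) hde)
  -- The coefficient ideals increase in both `k` and `d`. Past a maximal one at `(k₀, d₀)` they are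
  -- constant, so only the finitely many degrees below `d₀` need to stabilize separately.
  obtain ⟨J, ⟨⟨k₀, d₀⟩, rfl⟩, hmax⟩ := set_has_maximal_iff_noetherian.2
    (inferInstanceAs (IsNoetherian R R))
    (Set.range fun kd : ℕ × ℕ => Ideal.leadingCoeffNth (I kd.1) kd.2) (Set.range_nonempty _)
  have hlarge : ∀ k d, k₀ ≤ k → d₀ ≤ d →
      Ideal.leadingCoeffNth (I k) d = Ideal.leadingCoeffNth (I k₀) d₀ := fun k d hk hd =>
    ((hmono _ _ _ _ hk hd).lt_or_eq.resolve_left (hmax _ ⟨(k, d), rfl⟩)).symm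
  have hsmall : ∀ d, ∃ n, ∀ k, n ≤ k → Ideal.leadingCoeffNth (I n) d = Ideal.leadingCoeffNth (I k) d :=
    fun d => monotone_stabilizes_iff_noetherian.2 (inferInstanceAs (IsNoetherian R R))
      ⟨fun k => Ideal.leadingCoeffNth (I k) d, fun k l hkl => hmono k l d d hkl le_rfl⟩
  choose N hN using hsmall
  set K := k₀ + ∑ d ∈ Finset.range d₀, N d
  refine ⟨K, fun k hk => le_antisymm (I.monotone hk) ?_⟩
  refine Ideal.le_of_leadingCoeffNth_le (I.monotone hk) fun d => ?_
  rcases lt_or_ge d d₀ with hd | hd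
  · have hNd : N d ≤ K :=
      (Finset.single_le_sum (fun _ _ => Nat.zero_le _) (Finset.mem_range.2 hd)).trans
        (Nat.le_add_left _ _)
    rw [← hN d k (hNd.trans hk), hN d K hNd]
  · rw [hlarge k d (by omega) hd, hlarge K d (by omega) hd]

/-- Since `y` commutes with the smaller subring, evaluation at `y` is a ring homomorphism from its
polynomial ring onto the larger one. -/
theorem Subring.isNoetherianRing_closure_insert {E : Type*} [Ring E] (s : Set E) (y : E)
    (hy : ∀ a ∈ s, Commute a y) [IsNoetherianRing (Subring.closure s)] :
    IsNoetherianRing (Subring.closure (insert y s)) := by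
  have hcomm : ∀ a : Subring.closure s, Commute ((Subring.closure s).subtype a) y := by
    intro a
    have hle : Subring.closure s ≤ Subring.centralizer {y} := by
      rw [Subring.closure_le]
      intro b hb
      exact Subring.mem_centralizer_iff.2 fun g hg => by
        rw [Set.mem_singleton_iff.1 hg]; exact (hy b hb).eq.symm
    exact (Subring.mem_centralizer_iff.1 (hle a.2) y rfl).symm
  let φ := eval₂RingHom' (Subring.closure s).subtype y hcomm
  have hφ : Subring.closure (insert y s) = φ.range := by
    apply le_antisymm
    · rw [Subring.closure_le, Set.insert_subset_iff]
      refine ⟨⟨X, eval₂_X _ _⟩, fun a ha => ⟨C ⟨a, Subring.subset_closure ha⟩, eval₂_C _ _⟩⟩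
    · rintro _ ⟨f, rfl⟩
      change eval₂ _ _ f ∈ _
      rw [eval₂_eq_sum, Polynomial.sum]
      refine Subring.sum_mem _ fun i _ => Subring.mul_mem _
        (Subring.closure_mono (Set.subset_insert _ _) (f.coeff i).2)
        (Subring.pow_mem _ (Subring.subset_closure (Set.mem_insert _ _)) _)
  have := Polynomial.isNoetherianRing_of_ring (Subring.closure s)
  rw [hφ]
  infer_instance

theorem Subring.isNoetherianRing_closure_union {E D : Type*} [Ring E] [Ring D]
    [IsNoetherianRing D] (φ : D →+* E) (s : Set E) (hs : s.Finite)
    (hφ : ∀ a, ∀ y ∈ s, Commute (φ a) y) (hss : ∀ x ∈ s, ∀ y ∈ s, Commute x y) :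
    IsNoetherianRing (Subring.closure (Set.range φ ∪ s)) := by
  induction s, hs using Set.Finite.induction_on with
  | empty =>
    rw [Set.union_empty, ← RingHom.coe_range, Subring.closure_eq]
    infer_instance
  | @insert y s _ _ ih =>
    have := ih (fun a x hx => hφ a x (Set.mem_insert_of_mem _ hx))
      (fun x hx x' hx' => hss x (Set.mem_insert_of_mem _ hx) x' (Set.mem_insert_of_mem _ hx'))
    rw [Set.union_insert]
    apply Subring.isNoetherianRing_closure_insert
    rintro _ (⟨a, rfl⟩ | hx)
    · exact hφ a y (Set.mem_insert _ _)
    · exact hss _ (Set.mem_insert_of_mem _ hx) _ (Set.mem_insert _ _)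

end Noetherian

/-! ### Subspaces stable under commuting operators, and their chain condition. -/

section StableSubmodules

variable {D T V : Type*} [DivisionRing D] [CommRing T] [AddCommGroup V] [Module D V] [Module T V]

/-- The `D`-submodule spanned by all `b • v` with `b ∈ B` and `v ∈ F`. -/
def smulSpan (D : Type*) {T V : Type*} [DivisionRing D] [CommRing T] [AddCommGroup V] [Module D V]
    [Module T V] (B : Set T) (F : Set V) : Submodule D V :=
  Submodule.span D (Set.image2 (fun b v => b • v) B F)

/-- A `D`-submodule is stable under a set of scalars of `T`. -/
def IsStableUnder (S : Set T) (W : Submodule D V) : Prop :=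
  ∀ t ∈ S, ∀ w ∈ W, t • w ∈ W

theorem IsStableUnder.closure {S : Set T} {W : Submodule D V} (h : IsStableUnder S W) :
    IsStableUnder (Subring.closure S : Set T) W := by
  intro t ht
  induction ht using Subring.closure_induction with
  | mem x hx => exact h x hx
  | zero => exact fun w _ => by simp
  | one => exact fun w hw => by simpa using hw
  | add x y _ _ hx hy => exact fun w hw => by rw [add_smul]; exact W.add_mem (hx w hw) (hy w hw)
  | neg x _ hx => exact fun w hw => by rw [neg_smul]; exact W.neg_mem (hx w hw)
  | mul x y _ _ hx hy => exact fun w hw => by rw [mul_smul]; exact hx _ (hy w hw)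

theorem subset_smulSpan (B : Subring T) (F : Set V) : F ⊆ smulSpan D (B : Set T) F :=
  fun v hv => Submodule.subset_span ⟨1, B.one_mem, v, hv, one_smul _ _⟩

theorem smulSpan_le_of_isStableUnder {B : Set T} {F : Set V} {W : Submodule D V}
    (hW : IsStableUnder B W) (hF : F ⊆ W) : smulSpan D B F ≤ W := by
  rw [smulSpan, Submodule.span_le]
  rintro _ ⟨b, hb, v, hv, rfl⟩
  exact hW b hb v (hF hv)

variable [SMulCommClass D T V]

theorem isStableUnder_span {S : Set T} {G : Set V}
    (h : ∀ t ∈ S, ∀ g ∈ G, t • g ∈ Submodule.span D G) :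
    IsStableUnder S (Submodule.span D G) := by
  intro t ht w hw
  induction hw using Submodule.span_induction with
  | mem x hx => exact h t ht x hx
  | zero => simp
  | add x y _ _ hx hy => rw [smul_add]; exact add_mem hx hy
  | smul a x _ hx => rw [← smul_comm]; exact Submodule.smul_mem _ _ hx

theorem isStableUnder_smulSpan (B : Subring T) (F : Set V) :
    IsStableUnder (B : Set T) (smulSpan D (B : Set T) F) := by
  refine isStableUnder_span fun t ht g hg => ?_
  obtain ⟨b, hb, v, hv, rfl⟩ := hg
  refine Submodule.subset_span ⟨t * b, B.mul_mem ht hb, v, hv, mul_smul _ _ _⟩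

/-- The operators from `D` and `s` generate a Noetherian ring of endomorphisms. `V` is finitely
generated over it and the `U k` are submodules, so the chain stabilizes. -/
theorem exists_eq_succ_of_isStableUnder {s : Set T} (hs : s.Finite) {F : Set V} (hFin : F.Finite)
    (hF : smulSpan D (Subring.closure s : Set T) F = ⊤) (U : ℕ →o Submodule D V)
    (hU : ∀ k, IsStableUnder s (U k)) : ∃ k, U k = U (k + 1) := by
  let φ := Module.toAddMonoidEnd D V
  let ψ := Module.toAddMonoidEnd T V
  let S := Subring.closure (Set.range φ ∪ ψ '' s)
  have hS : IsNoetherianRing S := by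
    refine Subring.isNoetherianRing_closure_union φ _ (hs.image _) ?_ ?_
    · rintro a _ ⟨y, _, rfl⟩
      ext v
      exact smul_comm a y v
    · rintro _ ⟨x, _, rfl⟩ _ ⟨y, _, rfl⟩
      exact (Commute.all x y).map ψ
  have hDS : ∀ a : D, φ a ∈ S := fun a => Subring.subset_closure (Or.inl ⟨a, rfl⟩)
  have hTS : ∀ b ∈ Subring.closure s, ψ b ∈ S := by
    intro b hb
    have : Subring.closure s ≤ S.comap ψ := by
      rw [Subring.closure_le]
      exact fun t ht => Subring.subset_closure (Or.inr ⟨t, ht, rfl⟩)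
    exact this hb
  have hfin : Module.Finite S V := by
    refine ⟨⟨hFin.toFinset, ?_⟩⟩
    rw [Set.Finite.coe_toFinset, eq_top_iff]
    intro v _
    have hv : v ∈ smulSpan D (Subring.closure s : Set T) F := hF ▸ Submodule.mem_top
    induction hv using Submodule.span_induction with
    | mem x hx =>
      obtain ⟨b, hb, v, hv, rfl⟩ := hx
      exact Submodule.smul_mem (Submodule.span S F) (⟨ψ b, hTS b hb⟩ : S)
        (Submodule.subset_span hv)
    | zero => exact zero_mem _
    | add x y _ _ hx hy => exact add_mem (hx trivial) (hy trivial)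
    | smul a x _ hx => exact Submodule.smul_mem _ (⟨φ a, hDS a⟩ : S) (hx trivial)
  have hstab : ∀ k, ∀ e ∈ S, ∀ w ∈ U k, e w ∈ U k := by
    intro k e he
    induction he using Subring.closure_induction with
    | mem x hx =>
      obtain ⟨a, rfl⟩ | ⟨t, ht, rfl⟩ := hx
      · exact fun w hw => (U k).smul_mem a hw
      · exact fun w hw => hU k t ht w hw
    | zero => exact fun w _ => (U k).zero_mem
    | one => exact fun w hw => hw
    | add x y _ _ hx hy => exact fun w hw => (U k).add_mem (hx w hw) (hy w hw)
    | neg x _ hx => exact fun w hw => (U k).neg_mem (hx w hw)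
    | mul x y _ _ hx hy => exact fun w hw => hx _ (hy w hw)
  let U' : ℕ →o Submodule S V :=
    { toFun := fun k =>
        { carrier := U k
          add_mem' := (U k).add_mem
          zero_mem' := (U k).zero_mem
          smul_mem' := fun e w hw => hstab k e e.2 w hw }
      monotone' := fun k l hkl w hw => U.monotone hkl hw }
  obtain ⟨n, hn⟩ := monotone_stabilizes_iff_noetherian.2
    (inferInstanceAs (IsNoetherian S V)) U'
  refine ⟨n, ?_⟩
  ext w
  have := hn (n + 1) (Nat.le_succ n)
  exact (SetLike.ext_iff.1 this w)

end StableSubmodules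

/-! ### Nagata's change of variables. -/

section Nagata

open Polynomial

theorem sum_pow_mul_injective_of_lt {r e : ℕ} (he : 1 < e) {v w : Fin r →₀ ℕ}
    (hv : ∀ i, v i < e) (hw : ∀ i, w i < e)
    (h : ∑ i : Fin r, e ^ (i : ℕ) * v i = ∑ i : Fin r, e ^ (i : ℕ) * w i) : v = w := by
  refine Finsupp.ext <| congrFun <| List.ofFn_inj.mp ?_
  apply Nat.ofDigits_inj_of_len_eq he (by simp) (by simpa [List.mem_ofFn] using hv)
    (by simpa [List.mem_ofFn] using hw)
  simpa only [Nat.ofDigits_eq_sum_mapIdx, List.mapIdx_eq_ofFn, List.get_ofFn, List.length_ofFn,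
    Fin.val_cast, mul_comm, List.sum_ofFn] using! h

/-- Modulo `B` each further variable is a power of `y 0`, so a monomial becomes a monic polynomial
in `y 0` whose degree is read off from its exponents in base `e`. -/
theorem exists_monic_eval₂_eq_prod_pow {T : Type*} [CommRing T] [Nontrivial T] {r e : ℕ}
    (he : e ≠ 0) (y : Fin (r + 1) → T) (B : Subring T)
    (hB : ∀ i : Fin r, y i.succ - y 0 ^ e ^ (i + 1 : ℕ) ∈ B) (m : Fin (r + 1) →₀ ℕ) :
    ∃ P : B[X], P.Monic ∧ P.natDegree = ∑ i : Fin (r + 1), e ^ (i : ℕ) * m i ∧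
      P.eval₂ B.subtype (y 0) = ∏ i, y i ^ m i := by
  have hmon : ∀ i : Fin r, (X ^ e ^ (i + 1 : ℕ) + C (⟨_, hB i⟩ : B)).Monic :=
    fun i => monic_X_pow_add_C _ (pow_ne_zero _ he)
  refine ⟨X ^ m 0 * ∏ i : Fin r, (X ^ e ^ (i + 1 : ℕ) + C (⟨_, hB i⟩ : B)) ^ m i.succ,
    ?_, ?_, ?_⟩
  · exact (monic_X_pow _).mul (monic_prod_of_monic _ _ fun i _ => (hmon i).pow _)
  · rw [(monic_X_pow _).natDegree_mul (monic_prod_of_monic _ _ fun i _ => (hmon i).pow _),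
      natDegree_prod_of_monic _ _ fun i _ => (hmon i).pow _, Fin.sum_univ_succ]
    simp only [(hmon _).natDegree_pow, natDegree_X_pow_add_C, natDegree_X_pow]
    simp [mul_comm]
  · rw [eval₂_mul, eval₂_finsetProd, Fin.prod_univ_succ]
    simp [eval₂_pow]

variable {D T V : Type*} [DivisionRing D] [CommRing T] [AddCommGroup V] [Module D V] [Module T V]

theorem eval₂_smul_mem_smulSpan (B : Subring T) (z : T) (w : V) {N : ℕ} {P : B[X]}
    (hP : P.degree < N) :
    P.eval₂ B.subtype z • w ∈
      smulSpan D (B : Set T) ((fun j : ℕ => z ^ j • w) '' Set.Iio N) := by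
  rw [eval₂_eq_sum, Polynomial.sum, Finset.sum_smul]
  refine Submodule.sum_mem _ fun j hj => Submodule.subset_span
    ⟨B.subtype (P.coeff j), (P.coeff j).2, z ^ j • w, ⟨j, ?_, rfl⟩, (mul_smul _ _ _).symm⟩
  have : (j : WithBot ℕ) < N := (le_degree_of_mem_supp j hj).trans_lt hP
  exact_mod_cast this

variable [SMulCommClass D T V]

/-- After the substitution one monomial of the relation has strictly largest degree in `y 0`, so the
relation expresses a power of `y 0` on `w` through lower ones. The data `y'` and `N` depend on `l`
but not on `w`, which permits several generators at once. -/
theorem exists_smulSpan_le_of_sum_eq_zero [Nontrivial T] {r : ℕ} (y : Fin (r + 1) → T)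
    {l : (Fin (r + 1) →₀ ℕ) →₀ D} (hl : l ≠ 0) :
    ∃ (y' : Fin r → T) (N : ℕ), ∀ w : V,
      (l.sum fun m a => a • (∏ i, y i ^ m i) • w) = 0 →
      smulSpan D (Subring.closure (Set.range y) : Set T) {w} ≤
        smulSpan D (Subring.closure (Set.range y') : Set T)
          ((fun j : ℕ => y 0 ^ j • w) '' Set.Iio N) := by
  -- The base exceeds every exponent in `l`, so distinct monomials have distinct weights; the 2
  -- ensures `1 < e` even if all exponents vanish.
  set e := 2 + l.support.sup fun m => Finset.univ.sup m
  have hlt : ∀ m ∈ l.support, ∀ i, m i < e := by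
    intro m hm i
    have h1 : m i ≤ Finset.univ.sup m := Finset.le_sup (Finset.mem_univ i)
    have h2 : Finset.univ.sup m ≤ l.support.sup fun m => Finset.univ.sup m :=
      Finset.le_sup (f := fun m : Fin (r + 1) →₀ ℕ => Finset.univ.sup m) hm
    omega
  let wt : (Fin (r + 1) →₀ ℕ) → ℕ := fun m => ∑ i : Fin (r + 1), e ^ (i : ℕ) * m i
  obtain ⟨m₀, hm₀, hmax⟩ := l.support.exists_max_image wt (Finsupp.support_nonempty_iff.2 hl)
  set y' : Fin r → T := fun i => y i.succ - y 0 ^ e ^ (i + 1 : ℕ)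
  set B := Subring.closure (Set.range y')
  have hmem : ∀ i : Fin r, y i.succ - y 0 ^ e ^ (i + 1 : ℕ) ∈ B :=
    fun i => Subring.subset_closure ⟨i, rfl⟩
  choose P hPm hPd hPe using exists_monic_eval₂_eq_prod_pow (by omega : e ≠ 0) y B hmem
  refine ⟨y', wt m₀, fun w hw => ?_⟩
  set Q := smulSpan D (B : Set T) ((fun j : ℕ => y 0 ^ j • w) '' Set.Iio (wt m₀))
  have hlow : ∀ m ∈ l.support, m ≠ m₀ → (∏ i, y i ^ m i) • w ∈ Q := by
    intro m hm hne
    rw [← hPe m]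
    refine eval₂_smul_mem_smulSpan B (y 0) w ?_
    rw [degree_eq_natDegree (hPm m).ne_zero, hPd m]
    have : wt m < wt m₀ := lt_of_le_of_ne (hmax m hm) fun h =>
      hne (sum_pow_mul_injective_of_lt (by omega) (hlt m hm) (hlt m₀ hm₀) h)
    exact_mod_cast this
  have htop : (∏ i, y i ^ m₀ i) • w ∈ Q := by
    have h1 : l m₀ • (∏ i, y i ^ m₀ i) • w ∈ Q := by
      rw [Finsupp.sum, ← Finset.add_sum_erase _ _ hm₀] at hw
      rw [eq_neg_of_add_eq_zero_left hw]
      refine Q.neg_mem (Q.sum_mem fun m hm => Q.smul_mem _ ?_)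
      exact hlow m (Finset.mem_of_mem_erase hm) (Finset.ne_of_mem_erase hm)
    have := Q.smul_mem (l m₀)⁻¹ h1
    rwa [smul_smul, inv_mul_cancel₀ (Finsupp.mem_support_iff.1 hm₀), one_smul] at this
  have hzN : y 0 ^ wt m₀ • w ∈ Q := by
    have h1 : (P m₀ - X ^ wt m₀).eval₂ B.subtype (y 0) • w ∈ Q := by
      refine eval₂_smul_mem_smulSpan B (y 0) w ?_
      have hd : (P m₀).degree = wt m₀ := by
        rw [degree_eq_natDegree (hPm m₀).ne_zero, hPd m₀]
      rw [← hd]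
      refine degree_sub_lt_left ?_ (hPm m₀).ne_zero ?_
      · rw [hd, degree_X_pow]
      · rw [(hPm m₀).leadingCoeff, (monic_X_pow _).leadingCoeff]
    rw [eval₂_sub, hPe, eval₂_X_pow, sub_smul] at h1
    simpa using Q.sub_mem htop h1
  have hBQ : IsStableUnder (B : Set T) Q := isStableUnder_smulSpan B _
  have hzQ : ∀ q ∈ Q, y 0 • q ∈ Q := by
    have : IsStableUnder ({y 0} : Set T) Q := by
      refine isStableUnder_span ?_
      rintro _ rfl _ ⟨b, hb, _, ⟨j, hj, rfl⟩, rfl⟩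
      change y 0 • b • y 0 ^ j • w ∈ Q
      rw [smul_comm, smul_smul (y 0), ← pow_succ']
      refine hBQ b hb _ ?_
      rcases (Nat.succ_le_of_lt hj).lt_or_eq with h | h
      · exact subset_smulSpan B _ ⟨j + 1, h, rfl⟩
      · rwa [show y 0 ^ (j + 1) • w = y 0 ^ wt m₀ • w from congrArg (fun k => y 0 ^ k • w) h]
    exact this _ rfl
  have hzkQ : ∀ k, ∀ q ∈ Q, y 0 ^ k • q ∈ Q := by
    intro k
    induction k with
    | zero => simp
    | succ k ih => exact fun q hq => by rw [pow_succ, mul_smul]; exact ih _ (hzQ q hq)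
  refine smulSpan_le_of_isStableUnder (IsStableUnder.closure ?_) ?_
  · rintro _ ⟨i, rfl⟩ q hq
    induction i using Fin.cases with
    | zero => exact hzQ q hq
    | succ i =>
      rw [← sub_add_cancel (y i.succ) (y 0 ^ e ^ (i + 1 : ℕ)), add_smul]
      exact Q.add_mem (hBQ _ (hmem i) q hq) (hzkQ _ q hq)
  · rw [Set.singleton_subset_iff]
    -- At weight 0 there are no generators, but then `hzN` itself says `w ∈ Q`.
    rcases Nat.eq_zero_or_pos (wt m₀) with h | h
    · rw [h] at hzN
      simpa using hzN
    · exact subset_smulSpan B _ ⟨0, h, by simp⟩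

end Nagata

/-! ### Zariski's lemma: simple modules are finite-dimensional over `D`. -/

section FiniteDimensional

variable {D T V : Type*} [DivisionRing D] [CommRing T] [AddCommGroup V] [Module D V] [Module T V]
  [SMulCommClass D T V]

theorem smulSpan_closure_range_le {r : ℕ} (y : Fin r → T) (v : V) :
    smulSpan D (Subring.closure (Set.range y) : Set T) {v} ≤
      Submodule.span D (Set.range fun m : Fin r →₀ ℕ => (∏ i, y i ^ m i) • v) := by
  refine smulSpan_le_of_isStableUnder (IsStableUnder.closure (isStableUnder_span ?_)) ?_
  · rintro _ ⟨i, rfl⟩ _ ⟨m, rfl⟩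
    refine Submodule.subset_span ⟨m + Finsupp.single i 1, ?_⟩
    have : ∏ j, y j ^ (m + Finsupp.single i 1 : Fin r →₀ ℕ) j = y i * ∏ j, y j ^ m j := by
      simp only [Finsupp.add_apply, pow_add, Finset.prod_mul_distrib, mul_comm (y i)]
      congr 1
      rw [Finset.prod_eq_single i] <;> simp +contextual [eq_comm]
    simp only [this, mul_smul]
  · rw [Set.singleton_subset_iff]
    exact Submodule.subset_span (Set.mem_range.2 ⟨0, by simp⟩)

/-- If the monomials were independent on `v`, then `v` would not lie in `y 0` times the span `G` of
its monomial multiples. But `y 0` is surjective on the simple module, and stabilization of the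
preimages of `G` under its powers forces `v` into that image. -/
theorem linearDependent_prod_pow_of_finite
    (hs : ∀ W : Submodule D V, IsStableUnder (Set.univ : Set T) W → W = ⊥ ∨ W = ⊤) {r : ℕ}
    (y : Fin (r + 1) → T) {F : Set V} (hFin : F.Finite)
    (hF : smulSpan D (Subring.closure (Set.range y) : Set T) F = ⊤) (v : V) :
    ¬ LinearIndependent D fun m : Fin (r + 1) →₀ ℕ => (∏ i, y i ^ m i) • v := by
  intro hli
  have := SMulCommClass.symm D T V
  let f : Module.End D V := Module.toModuleEnd D (S := T) V (y 0)
  have hf : ∀ w, f w = y 0 • w := fun _ => rfl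
  have hsurj : LinearMap.range f = ⊤ := by
    refine (hs _ ?_).resolve_left fun h => ?_
    · rintro t - _ ⟨w, rfl⟩
      exact ⟨t • w, by rw [hf, hf, smul_comm]⟩
    · have h0 : y 0 • v = 0 := by
        rw [← hf]
        exact (Submodule.mem_bot D).1 (h ▸ LinearMap.mem_range_self f v)
      refine hli.ne_zero (Finsupp.single 0 1) ?_
      rw [Finset.prod_eq_single 0] <;> simp +contextual [eq_comm, h0]
  let G := smulSpan D (Subring.closure (Set.range y) : Set T) {v}
  have hG : IsStableUnder (Subring.closure (Set.range y) : Set T) G := isStableUnder_smulSpan _ _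
  let U : ℕ →o Submodule D V :=
    { toFun := fun k => G.comap (f ^ k)
      monotone' := monotone_nat_of_le_succ fun k w hw => by
        rw [Submodule.mem_comap, pow_succ', Module.End.mul_apply, hf]
        exact hG _ (Subring.subset_closure ⟨0, rfl⟩) _ hw }
  have hfk : ∀ k w, (f ^ k) w = y 0 ^ k • w := fun k w => by
    induction k with
    | zero => simp
    | succ k ih => rw [pow_succ', Module.End.mul_apply, ih, hf, pow_succ', mul_smul]
  obtain ⟨k, hk⟩ := exists_eq_succ_of_isStableUnder (Set.finite_range y) hFin hF U <| by
    rintro k t ht w hw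
    change (f ^ k) (t • w) ∈ G
    rw [hfk, smul_comm, ← hfk]
    exact hG _ (Subring.subset_closure ht) _ hw
  have hsurjk : Function.Surjective (f ^ (k + 1) : Module.End D V) := by
    rw [Module.End.coe_pow]
    exact (LinearMap.range_eq_top.1 hsurj).iterate _
  -- Write `v = y 0 ^ (k+1) • w`. Since `v ∈ G` and the chain is stationary at `k`, already `y 0 ^ k
  -- • w ∈ G`, so `v ∈ y 0 • G`.
  obtain ⟨w, hw⟩ := hsurjk v
  have hwk : w ∈ U k := by
    rw [hk]
    change (f ^ (k + 1)) w ∈ G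
    rw [hw]
    exact subset_smulSpan _ _ rfl
  have hvG : v ∈ G.map f := ⟨(f ^ k) w, hwk, by rw [← hw, pow_succ', Module.End.mul_apply]⟩
  have hle : G.map f ≤ Submodule.span D
      ((fun m : Fin (r + 1) →₀ ℕ => (∏ i, y i ^ m i) • v) '' {m | m ≠ 0}) := by
    refine (Submodule.map_mono (smulSpan_closure_range_le y v)).trans ?_
    rw [Submodule.map_span, Submodule.span_le]
    rintro _ ⟨_, ⟨m, rfl⟩, rfl⟩
    refine Submodule.subset_span ⟨m + Finsupp.single 0 1, ?_, ?_⟩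
    · intro h
      simpa using DFunLike.congr_fun h 0
    · simp only [hf, smul_smul, Fin.prod_univ_succ, Finsupp.add_apply, Finsupp.single_apply]
      simp [pow_succ', mul_assoc, (Fin.succ_ne_zero _).symm]
  refine hli.notMem_span_image (s := {m | m ≠ 0}) (x := 0) (by simp) ?_
  simpa using hle hvG

/-- A relation on `v` passes to `t • v` because `T` commutes with `D`, but not to `a • v` with `a ∈
D`. Generators are therefore chosen among the `T`-multiples of `v`, which span `V` over `D` by
simplicity. -/
theorem exists_finite_subset_span_smul
    (hs : ∀ W : Submodule D V, IsStableUnder (Set.univ : Set T) W → W = ⊥ ∨ W = ⊤)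
    {F : Set V} (hFin : F.Finite) {v : V} (hv : v ≠ 0) :
    ∃ G : Finset V, (G : Set V) ⊆ Set.range (fun t : T => t • v) ∧
      F ⊆ Submodule.span D (G : Set V) := by
  have htop : Submodule.span D (Set.range fun t : T => t • v) = ⊤ := by
    refine (hs _ (isStableUnder_span ?_)).resolve_left fun h => hv ?_
    · rintro t - _ ⟨u, rfl⟩
      exact Submodule.subset_span ⟨t * u, mul_smul _ _ _⟩
    · exact (Submodule.mem_bot D).1 (h ▸ Submodule.subset_span ⟨1, one_smul T v⟩)
  obtain ⟨G, hG, hFG⟩ := Submodule.subset_span_finite_of_subset_span (R := D)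
    (s := Set.range fun t : T => t • v) (t := hFin.toFinset) (by simp [htop])
  exact ⟨G, hG, by simpa using hFG⟩

/-- A simple module over `D[x₁,…,xᵣ]` (a `D`-space with commuting linear operators) which is
finitely generated over a polynomial subring is finite-dimensional over `D`. -/
theorem finite_of_smulSpan_eq_top [Nontrivial V]
    (hs : ∀ W : Submodule D V, IsStableUnder (Set.univ : Set T) W → W = ⊥ ∨ W = ⊤) {r : ℕ}
    (y : Fin r → T) {F : Set V} (hFin : F.Finite)
    (hF : smulSpan D (Subring.closure (Set.range y) : Set T) F = ⊤) : Module.Finite D V := by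
  induction r generalizing F with
  | zero =>
    refine ⟨⟨hFin.toFinset, ?_⟩⟩
    rw [Set.Finite.coe_toFinset, eq_top_iff, ← hF]
    refine smulSpan_le_of_isStableUnder (IsStableUnder.closure ?_) Submodule.subset_span
    rintro _ ⟨i, rfl⟩
    exact i.elim0
  | succ r ih =>
    have : Nontrivial T := Module.nontrivial T V
    have := SMulCommClass.symm D T V
    obtain ⟨v, hv⟩ := exists_ne (0 : V)
    have hdep := linearDependent_prod_pow_of_finite hs y hFin hF v
    rw [linearIndependent_iff] at hdep
    push Not at hdep
    obtain ⟨l, hl, hl0⟩ := hdep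
    rw [Finsupp.linearCombination_apply] at hl
    obtain ⟨y', N, hN⟩ := exists_smulSpan_le_of_sum_eq_zero (V := V) y hl0
    obtain ⟨G, hGv, hFG⟩ := exists_finite_subset_span_smul hs hFin hv
    refine ih y' (F := ⋃ w ∈ G, (fun j : ℕ => y 0 ^ j • w) '' Set.Iio N)
      (G.finite_toSet.biUnion fun w _ => (Set.finite_Iio N).image _) ?_
    rw [eq_top_iff, ← hF]
    have hB := isStableUnder_smulSpan (D := D) (Subring.closure (Set.range y)) (G : Set V)
    refine (smulSpan_le_of_isStableUnder hB (hFG.trans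
      (Submodule.span_le.2 (subset_smulSpan _ _)))).trans ?_
    rw [smulSpan, Submodule.span_le]
    rintro _ ⟨b, hb, w, hw, rfl⟩
    have hw0 : (l.sum fun m a => a • (∏ i, y i ^ m i) • w) = 0 := by
      obtain ⟨t, rfl⟩ := hGv hw
      have := congrArg (t • ·) hl
      simp only [Finsupp.sum, smul_zero, Finset.smul_sum] at this ⊢
      rw [← this]
      refine Finset.sum_congr rfl fun m _ => ?_
      rw [smul_comm t, smul_comm t]
    refine Submodule.span_mono (Set.image2_subset_left ?_)
      (hN w hw0 (Submodule.subset_span ⟨b, hb, w, rfl, rfl⟩))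
    exact Set.subset_biUnion_of_mem (u := fun w => (fun j : ℕ => y 0 ^ j • w) '' Set.Iio N) hw

end FiniteDimensional

/-! ### Common eigenvectors of commuting operators. -/

section Eigenvectors

open Polynomial

/-- The action of `E[X]` on an `E`-module in which `X` acts by a commuting scalar `t`. -/
noncomputable def polyAct (E : Type*) {T V : Type*} [Ring E] [CommRing T] [AddCommGroup V]
    [Module E V] [Module T V] [SMulCommClass E T V] (t : T) : E[X] →+* AddMonoid.End V :=
  eval₂RingHom' (Module.toAddMonoidEnd E V) (Module.toAddMonoidEnd T V t) fun a => by
    ext v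
    exact smul_comm a t v

section

variable {E T V : Type*} [Ring E] [CommRing T] [AddCommGroup V]
    [Module E V] [Module T V] [SMulCommClass E T V] (t : T)

theorem polyAct_C (a : E) (v : V) : polyAct E t (C a) v = a • v := by
  change (eval₂ (Module.toAddMonoidEnd E V) (Module.toAddMonoidEnd T V t) (C a)) v = _
  rw [eval₂_C]
  rfl

theorem polyAct_X (v : V) : polyAct E t X v = t • v := by
  change (eval₂ (Module.toAddMonoidEnd E V) (Module.toAddMonoidEnd T V t) X) v = _
  rw [eval₂_X]
  rfl

theorem polyAct_mul (f g : E[X]) (v : V) :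
    polyAct E t (f * g) v = polyAct E t f (polyAct E t g v) := by
  rw [map_mul]
  rfl

theorem polyAct_sub (f g : E[X]) (v : V) :
    polyAct E t (f - g) v = polyAct E t f v - polyAct E t g v := by
  rw [map_sub]
  rfl

theorem polyAct_monomial (n : ℕ) (a : E) (v : V) :
    polyAct E t (monomial n a) v = a • t ^ n • v := by
  induction n generalizing v with
  | zero => rw [monomial_zero_left, polyAct_C, pow_zero, one_smul]
  | succ n ih => rw [← monomial_mul_X, polyAct_mul, polyAct_X, ih, pow_succ, mul_smul]

theorem polyAct_eq_sum (f : E[X]) (v : V) :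
    polyAct E t f v = f.sum fun n a => a • t ^ n • v := by
  conv_lhs => rw [← f.sum_monomial_eq]
  simp only [Polynomial.sum, map_sum]
  refine (AddMonoidHom.finsetSum_apply (M := V) (N := V)
    (fun n => polyAct E t (monomial n (f.coeff n))) f.support v).trans ?_
  exact Finset.sum_congr rfl fun n _ => polyAct_monomial t n _ v

theorem polyAct_smul_of_commute (f : E[X]) (s : T) (v : V) :
    polyAct E t f (s • v) = s • polyAct E t f v := by
  have := SMulCommClass.symm E T V
  simp only [polyAct_eq_sum, Polynomial.sum, Finset.smul_sum]
  refine Finset.sum_congr rfl fun n _ => ?_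
  rw [smul_comm s, smul_comm s]

end

theorem Polynomial.exists_eq_mul_X_sub_C_add_C_eval {E : Type*} [Ring E] (f : E[X]) (b : E) :
    ∃ h : E[X], f = h * (X - C b) + C (f.eval b) := by
  induction f using Polynomial.induction_on' with
  | add p q hp hq =>
    obtain ⟨h, hh⟩ := hp
    obtain ⟨k, hk⟩ := hq
    refine ⟨h + k, ?_⟩
    rw [eval_add, map_add, add_mul]
    nth_rw 1 [hh, hk]
    abel
  | monomial n a =>
    induction n generalizing a with
    | zero => exact ⟨0, by simp⟩
    | succ n ih =>
      obtain ⟨h, hh⟩ := ih (a * b)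
      -- `aX^(n+1) = aX^n (X - b) + abX^n`, and induction applies to the last term.
      refine ⟨monomial n a + h, ?_⟩
      have h1 : (monomial (n + 1) a).eval b = (monomial n (a * b)).eval b := by
        simp [eval_monomial, pow_succ', mul_assoc]
      rw [h1, add_mul, add_assoc, ← hh, mul_sub, monomial_mul_X, monomial_mul_C, sub_add_cancel]

variable {D T V : Type*} [DivisionRing D] [CommRing T] [AddCommGroup V] [Module D V] [Module T V]
  [SMulCommClass D T V]

/-- A right root `b` of `f` gives a factorization `f = h(X - b)`. Either `w` is an eigenvector for
`b`, or `(t - b)w` is a nonzero vector of `W` killed by `h`, of lower degree. -/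
theorem exists_eigenvector_of_polyAct_eq_zero {E : Subring D} (hE : IsRightAlgClosed E) (t : T)
    (W : AddSubgroup V) (hWE : ∀ a ∈ E, ∀ w ∈ W, a • w ∈ W) (hWt : ∀ w ∈ W, t • w ∈ W)
    (f : E[X]) (hf : f ≠ 0) (w : V) (hw : w ∈ W) (hw0 : w ≠ 0) (hfw : polyAct E t f w = 0) :
    ∃ b ∈ E, ∃ u ∈ W, u ≠ 0 ∧ t • u = b • u := by
  induction hd : f.natDegree generalizing f w with
  | zero =>
    rw [eq_C_of_natDegree_eq_zero hd, polyAct_C] at hfw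
    have h1 : ((f.coeff 0 : E) : D) • w = 0 := hfw
    rcases smul_eq_zero.1 h1 with h | h
    · refine absurd ?_ hf
      rw [eq_C_of_natDegree_eq_zero hd, show f.coeff 0 = 0 from Subtype.ext h, C_0]
    · exact absurd h hw0
  | succ d ih =>
    obtain ⟨b, hb⟩ := hE f (by omega)
    obtain ⟨h, hh⟩ := f.exists_eq_mul_X_sub_C_add_C_eval b
    rw [hb, map_zero, add_zero] at hh
    have hact : polyAct E t (X - C b) w = t • w - (b : D) • w := by
      rw [polyAct_sub, polyAct_X, polyAct_C]
      rfl
    by_cases hu : t • w - (b : D) • w = 0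
    · exact ⟨b, b.2, w, hw, hw0, sub_eq_zero.1 hu⟩
    · have hh0 : h ≠ 0 := by
        rintro rfl
        exact hf (by rw [hh, zero_mul])
      refine ih h hh0 _ (W.sub_mem (hWt w hw) (hWE b b.2 w hw)) hu ?_ ?_
      · rw [← hact, ← polyAct_mul, ← hh, hfw]
      · rw [hh, natDegree_mul hh0 (X_sub_C_ne_zero b), natDegree_X_sub_C] at hd
        omega

theorem exists_polyAct_eq_zero [Module.Finite D V] (t : T) (v : V) :
    ∃ f : D[X], f ≠ 0 ∧ polyAct D t f v = 0 := by
  have hdep : ¬ LinearIndependent D fun n : ℕ => t ^ n • v := fun h =>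
    not_finite_iff_infinite.2 (inferInstanceAs (Infinite ℕ)) h.finite
  rw [linearIndependent_iff] at hdep
  push Not at hdep
  obtain ⟨l, hl, hl0⟩ := hdep
  refine ⟨⟨.ofCoeff l⟩, fun h => hl0 ?_, ?_⟩
  · ext n
    exact congrArg (fun f : D[X] => f.coeff n) h
  · rw [polyAct_eq_sum]
    exact hl

/-- The minimal polynomial of a common eigenvector has coefficients in the centralizer of the
eigenvalues. -/
theorem exists_polyAct_centralizer_eq_zero [Module.Finite D V] {n : ℕ} (x : Fin n → T)
    (c : Fin n → D) (t : T) {v : V} (hv : ∀ i, x i • v = c i • v) :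
    ∃ f : (Subring.centralizer (Set.range c))[X], f ≠ 0 ∧ polyAct _ t f v = 0 := by
  obtain ⟨f, ⟨hf0, hfv⟩, hmin⟩ := WellFounded.has_min
    (measure (natDegree : D[X] → ℕ)).wf {f | f ≠ 0 ∧ polyAct D t f v = 0}
    (exists_polyAct_eq_zero t v)
  set g := C f.leadingCoeff⁻¹ * f with hg
  have hlc : f.leadingCoeff⁻¹ * f.leadingCoeff = 1 :=
    inv_mul_cancel₀ (leadingCoeff_ne_zero.2 hf0)
  have hgm : g.Monic := monic_C_mul_of_mul_leadingCoeff_eq_one hlc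
  have hgd : g.natDegree = f.natDegree := by
    rw [hg, natDegree_C_mul (inv_ne_zero (leadingCoeff_ne_zero.2 hf0))]
  have hgv : polyAct D t g v = 0 := by rw [hg, polyAct_mul, hfv, map_zero]
  have hcoeff : ∀ i k, g.coeff k * c i = c i * g.coeff k := by
    intro i k
    -- The commutator kills `v`, because `g` applied to `c i • v = x i • v` is `x i` applied to `g v
    -- = 0`. As `g` is monic its top terms cancel, so minimality of the degree makes it zero.
    suffices h : g * C (c i) - C (c i) * g = 0 by
      have := congrArg (fun p => coeff p k) h
      simpa [sub_eq_zero] using this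
    by_contra hne
    refine hmin _ ⟨hne, ?_⟩ ?_
    · rw [polyAct_sub, polyAct_mul _ g, polyAct_mul _ (C (c i)), hgv, polyAct_C, ← hv,
        polyAct_smul_of_commute, hgv, smul_zero, map_zero, sub_zero]
    · change natDegree _ < natDegree f
      have hle : (g * C (c i) - C (c i) * g).natDegree ≤ f.natDegree := by
        refine (natDegree_sub_le _ _).trans (max_le ?_ ?_)
        · exact (natDegree_mul_C_le _ _).trans hgd.le
        · exact (natDegree_C_mul_le _ _).trans hgd.le
      refine lt_of_le_of_ne hle fun h => hne ?_
      rw [← leadingCoeff_eq_zero, leadingCoeff, h, ← hgd]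
      simp [coeff_natDegree, hgm.leadingCoeff]
  have hsub : (↑g.coeffs : Set D) ⊆ Subring.centralizer (Set.range c) := by
    intro a ha
    obtain ⟨k, -, rfl⟩ := mem_coeffs_iff.1 ha
    exact Subring.mem_centralizer_iff.2 (by rintro _ ⟨i, rfl⟩; exact (hcoeff i k).symm)
  refine ⟨g.toSubring _ hsub, fun h => hgm.ne_zero ?_, ?_⟩
  · ext k
    rw [← coeff_toSubring g _ hsub, h]
    simp
  · rw [← hgv, polyAct_eq_sum, polyAct_eq_sum, sum_def, sum_def, support_toSubring]
    refine Finset.sum_congr rfl fun k _ => ?_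
    rw [← coeff_toSubring g _ hsub]
    rfl

theorem exists_common_eigenvector (hD : IsCentrallyAlgClosed D) [Module.Finite D V]
    [Nontrivial V] {n : ℕ} (x : Fin n → T) :
    ∃ c ∈ CentralMvPoly.commutingPoints n D, ∃ v : V, v ≠ 0 ∧ ∀ i, x i • v = c i • v := by
  have := SMulCommClass.symm D T V
  induction n with
  | zero =>
    obtain ⟨v, hv⟩ := exists_ne (0 : V)
    exact ⟨Fin.elim0, fun i => i.elim0, v, hv, fun i => i.elim0⟩
  | succ n ih =>
    obtain ⟨c, hc, v, hv0, hv⟩ := ih fun i => x i.succ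
    obtain ⟨f, hf0, hfv⟩ := exists_polyAct_centralizer_eq_zero _ c (x 0) hv
    -- The eigenspace for fixed eigenvalues is stable under the centralizer of `c` but in general
    -- not under `D`. The next eigenvalue is therefore sought in that centralizer, which also makes
    -- it commute with the earlier ones.
    let W : AddSubgroup V :=
      { carrier := {w | ∀ i : Fin n, x i.succ • w = c i • w}
        zero_mem' := fun i => by simp
        add_mem' := fun ha hb i => by rw [smul_add, smul_add, ha i, hb i]
        neg_mem' := fun ha i => by rw [smul_neg, smul_neg, ha i] }
    obtain ⟨b, hb, u, hu, hu0, hub⟩ := exists_eigenvector_of_polyAct_eq_zero (hD n c hc) (x 0) W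
      (fun a ha w hw i => by
        rw [← smul_comm, hw i, smul_smul, smul_smul,
          Subring.mem_centralizer_iff.1 ha _ ⟨i, rfl⟩])
      (fun w hw i => by rw [smul_comm, hw i, smul_comm (x 0)]) f hf0 v hv hv0 hfv
    have hbc : ∀ i, c i * b = b * c i := fun i => Subring.mem_centralizer_iff.1 hb _ ⟨i, rfl⟩
    refine ⟨Fin.cons b c, ?_, u, hu0, ?_⟩
    · intro i j
      refine Fin.cases ?_ (fun i => ?_) i <;> refine Fin.cases ?_ (fun j => ?_) j
      · rfl
      · exact (hbc j).symm
      · exact hbc i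
      · exact hc i j
    · intro i
      refine Fin.cases hub (fun i => hu i) i

end Eigenvectors

/-! ### The weak Nullstellensatz. -/

section WeakNullstellensatz

/-- The center of `R` serves as the commutative ring of operators: `D`-subspaces stable under the `x
i` are exactly `R`-submodules, so simplicity carries over. -/
theorem exists_common_eigenvector_of_isSimpleModule {D : Type*} [DivisionRing D]
    (hD : IsCentrallyAlgClosed D) {R V : Type*} [Ring R] [AddCommGroup V] [Module R V]
    [IsSimpleModule R V] (ι : D →+* R) {n : ℕ} (x : Fin n → R)
    (hx : ∀ i, x i ∈ Subring.center R)
    (hgen : Subring.closure (Set.range ι ∪ Set.range x) = ⊤) :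
    ∃ c ∈ CentralMvPoly.commutingPoints n D, ∃ v : V, v ≠ 0 ∧ ∀ i, x i • v = ι (c i) • v := by
  let : Module D V := Module.compHom V ι
  have hι : ∀ (a : D) (v : V), a • v = ι a • v := fun _ _ => rfl
  have hcomm : SMulCommClass D (Subring.center R) V := by
    refine ⟨fun a t v => ?_⟩
    change ι a • (t : R) • v = (t : R) • ι a • v
    rw [smul_smul, smul_smul, Subring.mem_center_iff.1 t.2]
  let y : Fin n → Subring.center R := fun i => ⟨x i, hx i⟩
  have hyx : ∀ i (v : V), y i • v = x i • v := fun _ _ => rfl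
  have hs : ∀ W : Submodule D V, IsStableUnder (Set.range y) W → W = ⊥ ∨ W = ⊤ := by
    intro W hW
    have hR : ∀ r : R, ∀ w ∈ W, r • w ∈ W := by
      intro r
      have hr : r ∈ Subring.closure (Set.range ι ∪ Set.range x) := hgen ▸ Subring.mem_top r
      induction hr using Subring.closure_induction with
      | mem x hx =>
        obtain ⟨a, rfl⟩ | ⟨i, rfl⟩ := hx
        · exact fun w hw => W.smul_mem a hw
        · exact fun w hw => hW (y i) ⟨i, rfl⟩ w hw
      | zero => exact fun w _ => by simp
      | one => exact fun w hw => by simpa using hw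
      | add x y _ _ hx hy => exact fun w hw => by rw [add_smul]; exact W.add_mem (hx w hw) (hy w hw)
      | neg x _ hx => exact fun w hw => by rw [neg_smul]; exact W.neg_mem (hx w hw)
      | mul x y _ _ hx hy => exact fun w hw => by rw [mul_smul]; exact hx _ (hy w hw)
    let W' : Submodule R V :=
      { carrier := W
        add_mem' := W.add_mem
        zero_mem' := W.zero_mem
        smul_mem' := hR }
    have hW' : ∀ w, w ∈ W ↔ w ∈ W' := fun w => Iff.rfl
    rcases eq_bot_or_eq_top W' with h | h
    · left
      ext w
      rw [hW', h, Submodule.mem_bot, Submodule.mem_bot]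
    · right
      ext w
      rw [hW', h]
      simp
  have : Nontrivial V := IsSimpleModule.nontrivial R V
  obtain ⟨v, hv⟩ := exists_ne (0 : V)
  have hfg : smulSpan D (Subring.closure (Set.range y) : Set (Subring.center R)) {v} = ⊤ := by
    refine (hs _ fun t ht => isStableUnder_smulSpan _ _ t (Subring.subset_closure ht)).resolve_left
      fun h => hv ?_
    exact (Submodule.mem_bot D).1 (h ▸ subset_smulSpan _ _ rfl)
  have : Module.Finite D V := finite_of_smulSpan_eq_top
    (fun W hW => hs W fun t _ => hW t trivial) y (Set.finite_singleton v) hfg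
  exact exists_common_eigenvector hD y

/-- The weak Nullstellensatz: a proper left ideal of an algebra generated by `D` and central
elements `x₁,…,xₙ` is contained in the left ideal of a point with commuting coordinates. -/
theorem exists_le_forall_sub_mem {D : Type*} [DivisionRing D]
    (hD : IsCentrallyAlgClosed D) {R : Type*} [Ring R] (ι : D →+* R) {n : ℕ} (x : Fin n → R)
    (hx : ∀ i, x i ∈ Subring.center R)
    (hgen : Subring.closure (Set.range ι ∪ Set.range x) = ⊤) (J : Ideal R) (hJ : J ≠ ⊤) :
    ∃ c ∈ CentralMvPoly.commutingPoints n D, ∃ M : Ideal R, J ≤ M ∧ M ≠ ⊤ ∧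
      ∀ i, x i - ι (c i) ∈ M := by
  obtain ⟨M, hM, hJM⟩ := Ideal.exists_le_maximal J hJ
  have : IsSimpleModule R (R ⧸ M) := isSimpleModule_iff_isCoatom.2 hM.out
  obtain ⟨c, hc, v, hv0, hv⟩ :=
    exists_common_eigenvector_of_isSimpleModule (V := R ⧸ M) hD ι x hx hgen
  -- The line `D v` is stable under `R`, since the central `x i` sends `d v` to `d (c i) v`; hence
  -- the class of 1 lies on it.
  have hDv : ∀ r : R, ∀ d : D, ∃ e : D, r • ι d • v = ι e • v := by
    intro r
    have hr : r ∈ Subring.closure (Set.range ι ∪ Set.range x) := hgen ▸ Subring.mem_top r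
    induction hr using Subring.closure_induction with
    | mem y hy =>
      obtain ⟨a, rfl⟩ | ⟨i, rfl⟩ := hy
      · exact fun d => ⟨a * d, by rw [map_mul, mul_smul]⟩
      · refine fun d => ⟨d * c i, ?_⟩
        rw [smul_smul, ← Subring.mem_center_iff.1 (hx i), mul_smul, hv, map_mul, mul_smul]
    | zero => exact fun d => ⟨0, by simp⟩
    | one => exact fun d => ⟨d, one_smul _ _⟩
    | add x y _ _ hx hy =>
      intro d
      obtain ⟨e, he⟩ := hx d
      obtain ⟨e', he'⟩ := hy d
      exact ⟨e + e', by rw [add_smul, he, he', map_add, add_smul]⟩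
    | neg x _ hx =>
      intro d
      obtain ⟨e, he⟩ := hx d
      exact ⟨-e, by rw [neg_smul, he, map_neg, neg_smul]⟩
    | mul x y _ _ hx hy =>
      intro d
      obtain ⟨e, he⟩ := hy d
      obtain ⟨e', he'⟩ := hx e
      exact ⟨e', by rw [mul_smul, he, he']⟩
  obtain ⟨r, hr⟩ := IsSimpleModule.toSpanSingleton_surjective R hv0
    (Submodule.Quotient.mk (1 : R) : R ⧸ M)
  obtain ⟨d, hd⟩ := hDv r 1
  have hd1 : (Submodule.Quotient.mk (1 : R) : R ⧸ M) = ι d • v := by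
    rw [← hd, ← hr]
    simp
  have hd0 : d ≠ 0 := by
    rintro rfl
    rw [map_zero, zero_smul, Submodule.Quotient.mk_eq_zero] at hd1
    exact hM.ne_top ((Ideal.eq_top_iff_one M).2 hd1)
  -- If the class of 1 is `d v`, then `x i` multiplies it by the conjugate `d (c i) d⁻¹`.
  refine ⟨fun i => d * c i * d⁻¹, ?_, M, hJM, hM.ne_top, fun i => ?_⟩
  · intro i j
    have h : ∀ a b : D, d * a * d⁻¹ * (d * b * d⁻¹) = d * (a * b) * d⁻¹ := fun a b => by
      simp only [mul_assoc, inv_mul_cancel_left₀ hd0]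
    change d * c i * d⁻¹ * (d * c j * d⁻¹) = d * c j * d⁻¹ * (d * c i * d⁻¹)
    rw [h, h, hc i j]
  · rw [← Submodule.Quotient.mk_eq_zero, ← mul_one (x i - _), ← smul_eq_mul,
      Submodule.Quotient.mk_smul, hd1, sub_smul, sub_eq_zero, smul_smul,
      ← Subring.mem_center_iff.1 (hx i), mul_smul, hv, smul_smul, smul_smul, ← map_mul,
      ← map_mul, mul_assoc (d * c i), inv_mul_cancel₀ hd0, mul_one]

end WeakNullstellensatz

/-! ### Evaluation at commuting points and polynomials in one further indeterminate. -/

namespace CentralMvPoly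

open Polynomial (X)

section Eval

variable {n : ℕ} {D : Type*} [Ring D]

/-- The value of the monomial with exponent `m` at the point `c`. -/
def monomialValue (c : Fin n → D) (m : Fin n →₀ ℕ) : D :=
  (List.ofFn fun i => c i ^ m i).prod

-- The coordinates generate a commutative subring, in which the ordered product becomes an ordinary
-- finite product.
open scoped IsMulCommutative in
theorem monomialValue_add {c : Fin n → D} (hc : c ∈ commutingPoints n D) (m m' : Fin n →₀ ℕ) :
    monomialValue c (m + m') = monomialValue c m * monomialValue c m' := by
  have := Subring.isMulCommutative_closure (s := Set.range c) <| by
    rintro _ ⟨i, rfl⟩ _ ⟨j, rfl⟩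
    exact hc i j
  have h : ∀ m : Fin n →₀ ℕ, monomialValue c m =
      (Subring.closure (Set.range c)).subtype
        (∏ i, (⟨c i, Subring.subset_closure ⟨i, rfl⟩⟩ : Subring.closure (Set.range c)) ^ m i) := by
    intro m
    rw [← List.prod_ofFn, map_list_prod, List.map_ofFn]
    rfl
  rw [h, h, h, ← map_mul, ← Finset.prod_mul_distrib]
  simp only [Finsupp.add_apply, pow_add]

theorem monomialValue_mul_comm {c : Fin n → D} (hc : c ∈ commutingPoints n D)
    (m m' : Fin n →₀ ℕ) :
    monomialValue c m * monomialValue c m' = monomialValue c m' * monomialValue c m := by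
  rw [← monomialValue_add hc, ← monomialValue_add hc, add_comm]

theorem monomialValue_zero (c : Fin n → D) : monomialValue c 0 = 1 := by
  simp [monomialValue, List.prod_eq_one]

theorem monomialValue_single_one (c : Fin n → D) (i : Fin n) :
    monomialValue c (Finsupp.single i 1) = c i := by
  have : ∀ (k : ℕ) (c : Fin k → D) (i : Fin k),
      (List.ofFn fun j => c j ^ (Finsupp.single i 1 : Fin k →₀ ℕ) j).prod = c i := by
    intro k
    induction k with
    | zero => exact fun _ i => i.elim0
    | succ k ih =>
      intro c i
      rw [List.ofFn_succ, List.prod_cons]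
      refine Fin.cases ?_ (fun i => ?_) i
      · simp [List.prod_eq_one]
      · rw [← ih (fun j => c j.succ) i]
        simp [Finsupp.single_apply]
  exact this n c i

theorem eval_single (c : Fin n → D) (m : Fin n →₀ ℕ) (d : D) :
    eval c (AddMonoidAlgebra.single m d) = d * monomialValue c m := by
  rw [eval, AddMonoidAlgebra.coeff_single, Finsupp.sum_single_index (by simp)]
  rfl

theorem eval_zero (c : Fin n → D) : eval c (0 : CentralMvPoly n D) = 0 := by
  simp [eval]

theorem eval_add (c : Fin n → D) (f g : CentralMvPoly n D) :
    eval c (f + g) = eval c f + eval c g := by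
  rw [eval, AddMonoidAlgebra.coeff_add]
  exact Finsupp.sum_add_index' (by simp) fun _ _ _ => add_mul _ _ _

theorem eval_sum (c : Fin n → D) {α : Type*} (s : Finset α) (f : α → CentralMvPoly n D) :
    eval c (∑ i ∈ s, f i) = ∑ i ∈ s, eval c (f i) :=
  map_sum (⟨⟨eval c, eval_zero c⟩, eval_add c⟩ : CentralMvPoly n D →+ D) f s

theorem eval_C (c : Fin n → D) (a : D) : eval c (C a) = a := by
  rw [C, eval_single, monomialValue_zero, mul_one]

/-- On monomials, both sides agree because the monomial values at `c` commute with one another,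
though not with the coefficients. -/
theorem eval_mul {c : Fin n → D} (hc : c ∈ commutingPoints n D) (f g : CentralMvPoly n D) :
    eval c (f * g) = eval c (f * C (eval c g)) := by
  induction f using AddMonoidAlgebra.induction_linear with
  | zero => rw [zero_mul, zero_mul]
  | add f f' hf hf' => rw [add_mul, add_mul, eval_add, eval_add, hf, hf']
  | single m a =>
    induction g using AddMonoidAlgebra.induction_linear with
    | zero => rw [eval_zero, C, AddMonoidAlgebra.single_zero]
    | add g g' hg hg' =>
      rw [mul_add, eval_add, hg, hg', ← eval_add, ← mul_add, eval_add, C, C, C,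
        AddMonoidAlgebra.single_add]
    | single m' b =>
      rw [eval_single, C, AddMonoidAlgebra.single_mul_single, AddMonoidAlgebra.single_mul_single,
        eval_single, eval_single, add_zero, monomialValue_add hc, monomialValue_mul_comm hc]
      simp only [mul_assoc]

theorem eval_C_mul {c : Fin n → D} (hc : c ∈ commutingPoints n D) (a : D)
    (f : CentralMvPoly n D) : eval c (C a * f) = a * eval c f := by
  rw [eval_mul hc, C, C, AddMonoidAlgebra.single_mul_single, add_zero, ← C, eval_C]

theorem C_one : (C 1 : CentralMvPoly n D) = 1 := rfl

theorem eval_pow_eq_one {c : Fin n → D} (hc : c ∈ commutingPoints n D)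
    {q : CentralMvPoly n D} (hq : eval c q = 1) (k : ℕ) : eval c (q ^ k) = 1 := by
  induction k with
  | zero => rw [pow_zero, ← C_one, eval_C]
  | succ k ih => rw [pow_succ, eval_mul hc, hq, C_one, mul_one, ih]

theorem eval_mem_leftPowerSum_eq_zero {c : Fin n → D} {I : Ideal (CentralMvPoly n D)}
    (hc : c ∈ cZeroLocus (I : Set (CentralMvPoly n D))) {q f : CentralMvPoly n D}
    (hq : eval c q = 1) {N : ℕ} (hf : f ∈ leftPowerSum I q N) : eval c f = 0 := by
  obtain ⟨h, hI, rfl⟩ := hf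
  rw [eval_sum]
  refine Finset.sum_eq_zero fun k _ => ?_
  rw [eval_mul hc.1, eval_pow_eq_one hc.1 hq, C_one, mul_one, hc.2 _ (hI k)]

theorem mul_add_mem_leftPowerSum {I : Ideal (CentralMvPoly n D)} {q f h : CentralMvPoly n D}
    {N : ℕ} (hf : f ∈ leftPowerSum I q N) (hh : h ∈ I) :
    f * q + h ∈ leftPowerSum I q (N + 1) := by
  obtain ⟨g, hg, rfl⟩ := hf
  refine ⟨fun k => Nat.casesOn k h g, fun k => ?_, ?_⟩
  · cases k
    · exact hh
    · exact hg _
  · rw [Finset.sum_range_succ' _ (N + 1)]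
    simp [Finset.sum_mul, pow_succ, mul_assoc]

theorem single_one_mem_center (m : Fin n →₀ ℕ) :
    (AddMonoidAlgebra.single m 1 : CentralMvPoly n D) ∈ Subring.center (CentralMvPoly n D) :=
  Subring.mem_center_iff.2 fun f =>
    (AddMonoidAlgebra.single_commute (fun m' => AddCommute.all m m')
      (fun a => Commute.one_left a) f).eq.symm

theorem single_eq_C_mul (m : Fin n →₀ ℕ) (a : D) :
    (AddMonoidAlgebra.single m a : CentralMvPoly n D) = C a * AddMonoidAlgebra.single m 1 := by
  rw [C, AddMonoidAlgebra.single_mul_single, zero_add, mul_one]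

theorem single_add_one (m m' : Fin n →₀ ℕ) :
    (AddMonoidAlgebra.single (m + m') 1 : CentralMvPoly n D) =
      AddMonoidAlgebra.single m 1 * AddMonoidAlgebra.single m' 1 := by
  rw [AddMonoidAlgebra.single_mul_single, mul_one]

theorem exponent_induction {P : (Fin n →₀ ℕ) → Prop} (h0 : P 0)
    (h1 : ∀ i, P (Finsupp.single i 1)) (hadd : ∀ m m', P m → P m' → P (m + m')) (m) : P m := by
  induction m using Finsupp.induction_linear with
  | zero => exact h0
  | add m m' hm hm' => exact hadd m m' hm hm'
  | single i k =>
    induction k with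
    | zero => simpa using h0
    | succ k ih => rw [Finsupp.single_add]; exact hadd _ _ ih (h1 i)

/-- Constants as a ring homomorphism into polynomials in one further central indeterminate. -/
noncomputable def polyConst (n : ℕ) (D : Type*) [Ring D] : D →+* Polynomial (CentralMvPoly n D) :=
  Polynomial.C.comp AddMonoidAlgebra.singleZeroRingHom

theorem polyConst_apply (a : D) : polyConst n D a = Polynomial.C (C a) := rfl

/-- The indeterminates of `D[x₁,…,xₙ][X]`, with `X` first. -/
noncomputable def polyVar (n : ℕ) (D : Type*) [Ring D] :
    Fin (n + 1) → Polynomial (CentralMvPoly n D) :=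
  Fin.cons X fun i => Polynomial.C (AddMonoidAlgebra.single (Finsupp.single i 1) 1)

theorem polyC_single_one_mem_center (m : Fin n →₀ ℕ) :
    Polynomial.C (AddMonoidAlgebra.single m 1 : CentralMvPoly n D) ∈
      Subring.center (Polynomial (CentralMvPoly n D)) := by
  refine Subring.mem_center_iff.2 fun f => ?_
  ext1 k
  rw [Polynomial.coeff_mul_C, Polynomial.coeff_C_mul,
    Subring.mem_center_iff.1 (single_one_mem_center m)]

theorem polyVar_mem_center (i : Fin (n + 1)) :
    polyVar n D i ∈ Subring.center (Polynomial (CentralMvPoly n D)) := by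
  refine Fin.cases ?_ (fun i => ?_) i
  · exact Subring.mem_center_iff.2 fun f => (Polynomial.X_mul (p := f)).symm
  · exact polyC_single_one_mem_center _

theorem closure_polyConst_polyVar :
    Subring.closure (Set.range (polyConst n D) ∪ Set.range (polyVar n D)) = ⊤ := by
  rw [eq_top_iff]
  intro f _
  set S := Subring.closure (Set.range (polyConst n D) ∪ Set.range (polyVar n D))
  have hX : X ∈ S := Subring.subset_closure (Or.inr ⟨0, rfl⟩)
  have hone : ∀ m : Fin n →₀ ℕ,
      Polynomial.C (AddMonoidAlgebra.single m 1 : CentralMvPoly n D) ∈ S := by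
    refine exponent_induction ?_ (fun i => Subring.subset_closure (Or.inr ⟨i.succ, rfl⟩)) ?_
    · exact S.one_mem
    · intro m m' hm hm'
      rw [single_add_one, Polynomial.C_mul]
      exact S.mul_mem hm hm'
  have hC : ∀ g : CentralMvPoly n D, Polynomial.C g ∈ S := by
    intro g
    induction g using AddMonoidAlgebra.induction_linear with
    | zero => rw [Polynomial.C_0]; exact S.zero_mem
    | add g g' hg hg' => rw [Polynomial.C_add]; exact S.add_mem hg hg'
    | single m a =>
      rw [single_eq_C_mul, Polynomial.C_mul]
      exact S.mul_mem (Subring.subset_closure (Or.inl ⟨a, rfl⟩)) (hone m)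
  rw [← f.sum_C_mul_X_pow_eq]
  exact S.sum_mem fun k _ => S.mul_mem (hC _) (S.pow_mem hX k)

theorem polyC_sub_polyConst_eval_mem {M : Ideal (Polynomial (CentralMvPoly n D))}
    {c : Fin n → D} (hc : c ∈ commutingPoints n D)
    (hM : ∀ i : Fin n, Polynomial.C (AddMonoidAlgebra.single (Finsupp.single i 1) 1) -
      polyConst n D (c i) ∈ M) (f : CentralMvPoly n D) :
    Polynomial.C f - polyConst n D (eval c f) ∈ M := by
  have hone : ∀ m : Fin n →₀ ℕ,
      Polynomial.C (AddMonoidAlgebra.single m 1 : CentralMvPoly n D) -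
        polyConst n D (monomialValue c m) ∈ M := by
    refine exponent_induction ?_ (fun i => ?_) ?_
    · rw [monomialValue_zero, map_one, show (AddMonoidAlgebra.single 0 1 : CentralMvPoly n D) = 1
        from rfl, Polynomial.C_1, sub_self]
      exact M.zero_mem
    · rw [monomialValue_single_one]
      exact hM i
    · intro m m' hm hm'
      -- `M` absorbs only left factors. Centrality of `x^m` makes `x^m (x^m' - c^m') + c^m' (x^m -
      -- c^m)` telescope.
      have := M.add_mem (M.mul_mem_left (Polynomial.C (AddMonoidAlgebra.single m 1)) hm')
        (M.mul_mem_left (polyConst n D (monomialValue c m')) hm)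
      rw [mul_sub, mul_sub, ← Subring.mem_center_iff.1 (polyC_single_one_mem_center m)
        (polyConst n D (monomialValue c m')), sub_add_sub_cancel] at this
      rwa [single_add_one, Polynomial.C_mul, monomialValue_add hc, monomialValue_mul_comm hc,
        map_mul]
  induction f using AddMonoidAlgebra.induction_linear with
  | zero => rw [eval_zero, map_zero, map_zero, sub_zero]; exact M.zero_mem
  | add f g hf hg =>
    rw [eval_add, Polynomial.C_add, map_add, add_sub_add_comm]
    exact M.add_mem hf hg
  | single m a =>
    have := M.mul_mem_left (polyConst n D a) (hone m)
    rwa [mul_sub, ← map_mul, polyConst_apply, ← Polynomial.C_mul, ← single_eq_C_mul,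
      ← eval_single] at this

/-- The left ideal of polynomials in a further indeterminate with all coefficients in `I`. -/
def coeffIdeal (I : Ideal (CentralMvPoly n D)) : Ideal (Polynomial (CentralMvPoly n D)) where
  carrier := {f | ∀ k, f.coeff k ∈ I}
  add_mem' hf hg k := by rw [Polynomial.coeff_add]; exact I.add_mem (hf k) (hg k)
  zero_mem' k := by rw [Polynomial.coeff_zero]; exact I.zero_mem
  smul_mem' g f hf k := by
    rw [smul_eq_mul, Polynomial.coeff_mul]
    exact I.sum_mem fun ij _ => I.mul_mem_left _ (hf _)

/-- Write `1 = h + g(1 - qX)`. Coefficients give `g₀ = 1 - h₀` and `g_(k+1) = g_k q - h_(k+1)`, so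
`q^k - g_k` lies in the power sum by induction. Beyond the degree of `g` the term `g_k` vanishes. -/
theorem exists_pow_mem_leftPowerSum_of_sup_eq_top {I : Ideal (CentralMvPoly n D)}
    {q : CentralMvPoly n D}
    (hJ : coeffIdeal I ⊔ Ideal.span {1 - Polynomial.C q * X} = ⊤) :
    ∃ N : ℕ, 1 ≤ N ∧ q ^ N ∈ leftPowerSum I q N := by
  obtain ⟨h, hh, u, hu, h1⟩ := Submodule.mem_sup.1 ((Ideal.eq_top_iff_one _).1 hJ)
  obtain ⟨g, rfl⟩ := Ideal.mem_span_singleton'.1 hu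
  have key : ∀ k, q ^ k - g.coeff k ∈ leftPowerSum I q k := by
    intro k
    induction k with
    | zero =>
      have h0 := congrArg (fun f => f.coeff 0) h1
      simp only [Polynomial.coeff_add, mul_sub, mul_one, Polynomial.coeff_sub, ← mul_assoc,
        Polynomial.coeff_mul_X_zero, sub_zero, Polynomial.coeff_one_zero] at h0
      refine ⟨fun _ => h.coeff 0, fun _ => hh 0, ?_⟩
      have h0' : 1 - g.coeff 0 = h.coeff 0 := by rw [← h0, add_sub_cancel_right]
      simp [h0']
    | succ k ih =>
      have hk := congrArg (fun f => f.coeff (k + 1)) h1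
      simp only [Polynomial.coeff_add, mul_sub, mul_one, Polynomial.coeff_sub, ← mul_assoc,
        Polynomial.coeff_mul_X, Polynomial.coeff_mul_C, Polynomial.coeff_one,
        Nat.succ_ne_zero, if_false] at hk
      have := mul_add_mem_leftPowerSum ih (hh (k + 1))
      convert this using 1
      rw [sub_mul, ← pow_succ, sub_add, sub_right_inj, eq_sub_iff_add_eq, ← sub_eq_zero, ← hk]
      abel
  refine ⟨g.natDegree + 1, by omega, ?_⟩
  simpa [Polynomial.coeff_eq_zero_of_natDegree_lt (Nat.lt_succ_self g.natDegree)] using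
    key (g.natDegree + 1)

end Eval

/-! ### Rabinowitsch's trick and the Nullstellensatz. -/

variable {n : ℕ} {D : Type*} [DivisionRing D]

theorem exists_pow_mem_leftPowerSum (hD : IsCentrallyAlgClosed D)
    (I : Ideal (CentralMvPoly n D)) (q : CentralMvPoly n D)
    (hq : ∀ c ∈ cZeroLocus (I : Set (CentralMvPoly n D)), eval c q = 0) :
    ∃ N : ℕ, 1 ≤ N ∧ q ^ N ∈ leftPowerSum I q N := by
  refine exists_pow_mem_leftPowerSum_of_sup_eq_top ?_
  by_contra hJ
  obtain ⟨c, hc, M, hJM, hM, hcM⟩ := exists_le_forall_sub_mem hD (polyConst n D) (polyVar n D)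
    polyVar_mem_center closure_polyConst_polyVar _ hJ
  -- Coordinate 0 belongs to the auxiliary `X` and is discarded.
  have hc' : (fun i : Fin n => c i.succ) ∈ commutingPoints n D := fun i j => hc i.succ j.succ
  have heval := polyC_sub_polyConst_eval_mem hc' fun i => hcM i.succ
  have hlocus : (fun i : Fin n => c i.succ) ∈ cZeroLocus (I : Set (CentralMvPoly n D)) := by
    refine ⟨hc', fun f hf => ?_⟩
    have hfM : Polynomial.C f ∈ M := hJM <| Ideal.mem_sup_left fun k => by
      rw [Polynomial.coeff_C]
      split_ifs
      exacts [hf, I.zero_mem]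
    have hconst : polyConst n D (eval (fun i : Fin n => c i.succ) f) ∈ M := by
      simpa using M.sub_mem hfM (heval f)
    by_contra h0
    refine hM ((Ideal.eq_top_iff_one M).2 ?_)
    have := M.mul_mem_left (polyConst n D (eval (fun i : Fin n => c i.succ) f)⁻¹) hconst
    rwa [← map_mul, inv_mul_cancel₀ h0, map_one] at this
  have hqM : Polynomial.C q ∈ M := by
    have := heval q
    rwa [hq _ hlocus, map_zero, sub_zero] at this
  have h1 : (1 : Polynomial (CentralMvPoly n D)) - Polynomial.C q * X ∈ M :=
    hJM (Ideal.mem_sup_right (Ideal.subset_span rfl))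
  have h2 : Polynomial.C q * X ∈ M := by
    rw [← Polynomial.X_mul]
    exact M.mul_mem_left _ hqM
  exact hM ((Ideal.eq_top_iff_one M).2 (by simpa using M.add_mem h1 h2))

end CentralMvPoly

theorem mainTheorem3 {D : Type*} [DivisionRing D] (hD : IsCentrallyAlgClosed D) (n : ℕ)
    (I : Ideal (CentralMvPoly n D)) (p : CentralMvPoly n D) :
    (∀ c ∈ CentralMvPoly.cZeroLocus (I : Set (CentralMvPoly n D)), CentralMvPoly.eval c p = 0) ↔
      ∀ a : D, ∃ N : ℕ, 1 ≤ N ∧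
        (CentralMvPoly.C a * p) ^ N ∈
          CentralMvPoly.leftPowerSum I (CentralMvPoly.C a * p) N := by
  constructor
  · intro hp a
    refine CentralMvPoly.exists_pow_mem_leftPowerSum hD I _ fun c hc => ?_
    rw [CentralMvPoly.eval_C_mul hc.1, hp c hc, mul_zero]
  · intro h c hc
    by_contra h0
    -- This choice of `a` normalizes the value of `ap` at `c` to 1.
    obtain ⟨N, -, hN⟩ := h (CentralMvPoly.eval c p)⁻¹
    have hq : CentralMvPoly.eval c (CentralMvPoly.C (CentralMvPoly.eval c p)⁻¹ * p) = 1 := by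
      rw [CentralMvPoly.eval_C_mul hc.1, inv_mul_cancel₀ h0]
    have h1 := CentralMvPoly.eval_mem_leftPowerSum_eq_zero hc hq hN
    rw [CentralMvPoly.eval_pow_eq_one hc.1 hq] at h1
    exact one_ne_zero h1
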